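/- Let $a_x^\dagger=\frac1{\sqrt2}(x-\partial_x)$, $a_x=\frac1{\sqrt2}(x+\partial_x)$, and similarly $a_y^\dagger,a_y$. For $m,n\in\mathbb{N}_0$ let $$\psi_m^n=(m!\,n!)^{-1/2}(a_x^\dagger)^m(a_y^\dagger)^n\psi_0^0,\qquad \psi_0^0(x,y)=\pi^{-1/2}e^{-(x^2+y^2)/2},$$ be the Hermite--Gaussian modes in $L^2(\mathbb{R}^2)=L^2(\mathbb{R}^2;\mathbb{C})$. Let $\hat{\mathcal T}_4$ be the operator $$\hat{\mathcal T}_4=\tfrac12\bigl(a_x^\dagger+a_x-a_x^\dagger a_x^\dagger a_x-a_x^\dagger a_xa_x-a_x^\dagger a_y^\dagger a_y-a_xa_y^\dagger a_y\bigr)$$ whose domain is the space of finite linear combinations of the $\psi_m^n$. Let $P_n$ be the orthogonal projection of $L^2(\mathbb{R}^2)$ onto the closed span of $\{\psi_m^n:m\ge0\}$. Put $\beta_m^n=\frac12\sqrt{m+1}\,(1-m-n)$ and, for complex sequences $g=(g_m)_{m\ge 0}$ and $h=(h_m)_{m\ge 0}$, $$[g,h]_m^n=\beta_m^n\bigl(g_m\overline{h_{m+1}}-g_{m+1}\overline{h_m}\bigr),\qquad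 [g,h]_\infty^n=\lim_{m\to\infty}[g,h]_m^n$$ whenever the limit exists; a function $f$ in the range of $P_n$ is identified with the sequence of its coefficients $f_m=\langle f|\psi_m^n\rangle$, where $\langle\cdot|\cdot\rangle$ is linear in its first entry. Let $s_0=2$, $s_1=1$, and $s_n=0$ for $n\ge2$. Let $u^n$ and $v^n$ be the sequences that vanish at all indices $m<s_n$, satisfy $\beta_{m-1}^ny_{m-1}+\beta_m^ny_{m+1}=0$ for all $m\ge s_n+1$, and have the initial values $$u^n_{s_n}=1,\quad u^n_{s_n+1}=0,\qquad v^n_{s_n}=0,\quad v^n_{s_n+1}=1/\beta^n_{s_n}.$$ For $f\in D(\hat{\mathcal T}_4^*)$ in the range of $P_n$ put $\Gamma_1^n(f)=[f,v^n]_\infty^n$ and $\Gamma_2^n(f)=[f,u^n]_\infty^n$. \textbf{Theorem.} The operator $\hat{\mathcal T}_4$ is densely defined and closable. For all $f\in D(\hat{\mathcal T}_4^*)$ and $n\ge0$ we have $P_nf\in D(\hat{\mathcal T}_4^*)$, and the limits that define $\Gamma_1^n(P_nf)$ and $\Gamma_2^n(P_nf)$ exist. The closure of $\hat{\mathcal T}_4$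 is the restriction of $\hat{\mathcal T}_4^*$ to $$\mathcal D_{cl}=\{f\in D(\hat{\mathcal T}_4^*):\ \Gamma_1^n(P_nf)=\Gamma_2^n(P_nf)=0\ \text{ for all } n\ge0\}.$$ -/

import Mathlib

open MeasureTheory Filter Topology
open scoped SchwartzMap LineDeriv ComplexConjugate ENNReal

noncomputable section

namespace NonGaussian

/-- The complex Hilbert space of square integrable functions of two real variables `(x, y)`. -/
abbrev L2Plane : Type := Lp ℂ 2 (volume : Measure (ℝ × ℝ))

/-- The Schwartz space of two real variables `(x, y)`. -/
abbrev Sch : Type := 𝓢(ℝ × ℝ, ℂ)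

/-! ### Schwartz functions as elements of the Hilbert space -/

/-- The linear map sending a Schwartz function to its class in the Hilbert space. -/
def toL2 : Sch →ₗ[ℂ] L2Plane :=
  (SchwartzMap.toLpCLM ℂ ℂ 2 (volume : Measure (ℝ × ℝ))).toLinearMap

theorem toL2_injective : Function.Injective toL2 :=
  SchwartzMap.injective_toLp (E := ℝ × ℝ) (F := ℂ) 2 volume

/-! ### Position, derivative, creation and annihilation operators -/

theorem hasTemperateGrowth_fst : (fun p : ℝ × ℝ => (p.1 : ℂ)).HasTemperateGrowth :=
  (Complex.ofRealCLM.comp (ContinuousLinearMap.fst ℝ ℝ ℝ)).hasTemperateGrowth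

theorem hasTemperateGrowth_snd : (fun p : ℝ × ℝ => (p.2 : ℂ)).HasTemperateGrowth :=
  (Complex.ofRealCLM.comp (ContinuousLinearMap.snd ℝ ℝ ℝ)).hasTemperateGrowth

/-- Multiplication by `x`. -/
def mulX : Module.End ℂ Sch :=
  (SchwartzMap.smulLeftCLM ℂ (fun p : ℝ × ℝ => (p.1 : ℂ))).toLinearMap

/-- Multiplication by `y`. -/
def mulY : Module.End ℂ Sch :=
  (SchwartzMap.smulLeftCLM ℂ (fun p : ℝ × ℝ => (p.2 : ℂ))).toLinearMap

theorem mulX_apply (f : Sch) (p : ℝ × ℝ) : mulX f p = (p.1 : ℂ) * f p :=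
  SchwartzMap.smulLeftCLM_apply_apply hasTemperateGrowth_fst f p

theorem mulY_apply (f : Sch) (p : ℝ × ℝ) : mulY f p = (p.2 : ℂ) * f p :=
  SchwartzMap.smulLeftCLM_apply_apply hasTemperateGrowth_snd f p

/-- The partial derivative `∂/∂x`. -/
def dX : Module.End ℂ Sch :=
  (LineDeriv.lineDerivOpCLM ℂ Sch ((1, 0) : ℝ × ℝ)).toLinearMap

/-- The partial derivative `∂/∂y`. -/
def dY : Module.End ℂ Sch :=
  (LineDeriv.lineDerivOpCLM ℂ Sch ((0, 1) : ℝ × ℝ)).toLinearMap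

/-- The creation operator `(x - ∂/∂x) / √2`. -/
def creX : Module.End ℂ Sch := ((√2 : ℝ) : ℂ)⁻¹ • (mulX - dX)

/-- The annihilation operator `(x + ∂/∂x) / √2`. -/
def annX : Module.End ℂ Sch := ((√2 : ℝ) : ℂ)⁻¹ • (mulX + dX)

/-- The creation operator `(y - ∂/∂y) / √2`. -/
def creY : Module.End ℂ Sch := ((√2 : ℝ) : ℂ)⁻¹ • (mulY - dY)

/-- The annihilation operator `(y + ∂/∂y) / √2`. -/
def annY : Module.End ℂ Sch := ((√2 : ℝ) : ℂ)⁻¹ • (mulY + dY)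

/-- The cubic generator, as a differential expression acting on Schwartz functions; the product
of endomorphisms is composition. -/
def t4Expr : Module.End ℂ Sch :=
  (1 / 2 : ℂ) • (creX + annX - creX * creX * annX - creX * annX * annX
    - creX * creY * annY - annX * creY * annY)

/-! ### Hermite-Gaussian modes -/

/-- The exponent of the Gaussian. -/
def gaussExponent (p : ℝ × ℝ) : ℝ := -(p.1 ^ 2 + p.2 ^ 2) / 2

theorem gaussExponent_contDiff {k : WithTop ℕ∞} : ContDiff ℝ k gaussExponent := by
  unfold gaussExponent
  fun_prop

theorem gaussExponent_hasTemperateGrowth : gaussExponent.HasTemperateGrowth := by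
  have h1 : (fun p : ℝ × ℝ => p.1).HasTemperateGrowth :=
    (ContinuousLinearMap.fst ℝ ℝ ℝ).hasTemperateGrowth
  have h2 : (fun p : ℝ × ℝ => p.2).HasTemperateGrowth :=
    (ContinuousLinearMap.snd ℝ ℝ ℝ).hasTemperateGrowth
  have h : gaussExponent = fun p : ℝ × ℝ => (-1 / 2 : ℝ) * (p.1 * p.1 + p.2 * p.2) := by
    funext p
    simp only [gaussExponent]
    ring
  rw [h]
  exact (Function.HasTemperateGrowth.const _).mul ((h1.mul h1).add (h2.mul h2))

theorem gaussExponent_le (p : ℝ × ℝ) : gaussExponent p ≤ 3 / 2 - (1 + ‖p‖) := by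
  have h : ‖p‖ ^ 2 ≤ p.1 ^ 2 + p.2 ^ 2 := by
    rcases max_choice ‖p.1‖ ‖p.2‖ with h | h <;> rw [Prod.norm_def, h, Real.norm_eq_abs, sq_abs]
    · nlinarith [sq_nonneg p.2]
    · nlinarith [sq_nonneg p.1]
  unfold gaussExponent
  nlinarith [sq_nonneg (‖p‖ - 1)]

theorem gauss_decay (k n : ℕ) : ∃ C : ℝ, ∀ p : ℝ × ℝ,
    ‖p‖ ^ k * ‖iteratedFDeriv ℝ n (fun q => Complex.exp (gaussExponent q : ℂ)) p‖ ≤ C := by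
  obtain ⟨l, C, hC, hb⟩ := gaussExponent_hasTemperateGrowth.norm_iteratedFDeriv_le_uniform n
  have key : ∀ p : ℝ × ℝ, ‖iteratedFDeriv ℝ n (fun q => Real.exp (gaussExponent q)) p‖ ≤
      n.factorial * Real.exp (gaussExponent p) * ((1 + C) * (1 + ‖p‖) ^ l) ^ n := by
    intro p
    have h1 : (1 : ℝ) ≤ (1 + ‖p‖) ^ l := one_le_pow₀ (by linarith [norm_nonneg p])
    refine norm_iteratedFDeriv_comp_le (g := Real.exp) (f := gaussExponent) (N := n)
      (Real.contDiff_exp) gaussExponent_contDiff le_rfl p ?_ ?_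
    · intro i _
      rw [norm_iteratedFDeriv_eq_norm_iteratedDeriv, iteratedDeriv_eq_iterate,
        Real.iter_deriv_exp, Real.norm_eq_abs, abs_of_pos (Real.exp_pos _)]
    · intro i hi hin
      refine (hb i hin p).trans ?_
      have h2 : (1 : ℝ) ≤ (1 + C) * (1 + ‖p‖) ^ l := by nlinarith
      calc C * (1 + ‖p‖) ^ l ≤ (1 + C) * (1 + ‖p‖) ^ l := by nlinarith
        _ ≤ ((1 + C) * (1 + ‖p‖) ^ l) ^ i := le_self_pow₀ h2 (by omega)
  refine ⟨n.factorial * (1 + C) ^ n * ((k + l * n).factorial * Real.exp (3 / 2)), fun p => ?_⟩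
  have e1 : (fun q => Complex.exp (gaussExponent q : ℂ)) =
      Complex.ofRealLI ∘ fun q => Real.exp (gaussExponent q) := by
    funext q
    simp
  rw [e1, LinearIsometry.norm_iteratedFDeriv_comp_left (n := n) _
    (gaussExponent_contDiff.exp).contDiffAt le_rfl]
  have hp := norm_nonneg p
  have e2 : Real.exp (gaussExponent p) * (1 + ‖p‖) ^ (k + l * n) ≤
      (k + l * n).factorial * Real.exp (3 / 2) := by
    have h3 := Real.pow_div_factorial_le_exp (1 + ‖p‖) (by linarith) (k + l * n)
    rw [div_le_iff₀ (by positivity)] at h3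
    calc Real.exp (gaussExponent p) * (1 + ‖p‖) ^ (k + l * n)
        ≤ Real.exp (3 / 2 - (1 + ‖p‖)) *
            (Real.exp (1 + ‖p‖) * (k + l * n).factorial) := by
          gcongr
          exact gaussExponent_le p
      _ = (k + l * n).factorial * Real.exp (3 / 2) := by
          rw [← mul_assoc, ← Real.exp_add, mul_comm]
          congr 2
          ring
  calc ‖p‖ ^ k * ‖iteratedFDeriv ℝ n (fun q => Real.exp (gaussExponent q)) p‖
      ≤ (1 + ‖p‖) ^ k *
          (n.factorial * Real.exp (gaussExponent p) * ((1 + C) * (1 + ‖p‖) ^ l) ^ n) := by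
        gcongr
        · linarith
        · exact key p
    _ = n.factorial * (1 + C) ^ n *
          (Real.exp (gaussExponent p) * (1 + ‖p‖) ^ (k + l * n)) := by
        rw [mul_pow, pow_add, pow_mul]
        ring
    _ ≤ _ := by gcongr

/-- The Gaussian `exp (-(x ^ 2 + y ^ 2) / 2)` as a Schwartz function. -/
def gaussian : Sch where
  toFun p := Complex.exp (gaussExponent p : ℂ)
  smooth' := (Complex.ofRealCLM.contDiff.comp gaussExponent_contDiff).cexp
  decay' := gauss_decay

/-- The normalized ground state `π ^ (-1/2) * exp (-(x ^ 2 + y ^ 2) / 2)`. -/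
def groundState : Sch := ((√Real.pi : ℝ) : ℂ)⁻¹ • gaussian

/-- The Hermite-Gaussian mode `|m, n⟩`, of order `m` in `x` and `n` in `y`. -/
def modeFun (m n : ℕ) : Sch :=
  ((√((m.factorial : ℝ) * (n.factorial : ℝ)) : ℝ) : ℂ)⁻¹ • (creX ^ m * creY ^ n) groundState

/-- The Hermite-Gaussian mode `ψ_m^n = |m, n⟩` as an element of the Hilbert space. -/
def mode (m n : ℕ) : L2Plane := toL2 (modeFun m n)

/-- Finite linear combinations of Hermite-Gaussian modes. -/
def modeSpan : Submodule ℂ Sch := Submodule.span ℂ (Set.range fun k : ℕ × ℕ => modeFun k.1 k.2)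

/-! ### The operator -/

/-- The unbounded operator whose domain consists of the finite linear combinations of
Hermite-Gaussian modes, on which it acts by the differential expression `t4Expr`. -/
def T4 : L2Plane →ₗ.[ℂ] L2Plane where
  domain := modeSpan.map toL2
  toFun := toL2 ∘ₗ t4Expr ∘ₗ modeSpan.subtype ∘ₗ
    (Submodule.equivMapOfInjective toL2 toL2_injective modeSpan).symm.toLinearMap

theorem T4_apply (f : Sch) (hf : f ∈ modeSpan) :
    T4 ⟨toL2 f, Submodule.mem_map_of_mem hf⟩ = toL2 (t4Expr f) := by
  have h : (Submodule.equivMapOfInjective toL2 toL2_injective modeSpan).symm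
      ⟨toL2 f, Submodule.mem_map_of_mem hf⟩ = ⟨f, hf⟩ := by
    rw [LinearEquiv.symm_apply_eq]
    rfl
  change toL2 (t4Expr ((Submodule.equivMapOfInjective toL2 toL2_injective modeSpan).symm
      ⟨toL2 f, Submodule.mem_map_of_mem hf⟩ : Sch)) = _
  rw [h]

/-! ### Sectors, brackets and boundary values at infinity -/

/-- The closed subspace spanned by the modes of order `n` in `y`. -/
def sector (n : ℕ) : Submodule ℂ L2Plane :=
  (Submodule.span ℂ (Set.range fun m : ℕ => mode m n)).topologicalClosure

/-- The orthogonal projection onto the `n`-th sector. -/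
def P (n : ℕ) : L2Plane →L[ℂ] L2Plane :=
  haveI : CompleteSpace (sector n) :=
    (Submodule.isClosed_topologicalClosure _).completeSpace_coe
  (sector n).starProjection

/-- The sequence of coefficients `f_m^n`, `m = 0, 1, …`, of `f` in the `n`-th sector. -/
def coeff (n : ℕ) (f : L2Plane) (m : ℕ) : ℂ := inner ℂ (mode m n) f

/-- The Jacobi matrix entries `β_m^n = √(m + 1) (1 - m - n) / 2`. -/
def beta (n m : ℕ) : ℝ := 1 / 2 * √((m : ℝ) + 1) * (1 - (m : ℝ) - (n : ℝ))

/-- The bracket `[g, h]_m^n`. -/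
def bracket (n : ℕ) (g h : ℕ → ℂ) (m : ℕ) : ℂ :=
  (beta n m : ℂ) * (g m * conj (h (m + 1)) - g (m + 1) * conj (h m))

/-- The bracket at infinity `[g, h]_∞^n`. -/
def bracketInfty (n : ℕ) (g h : ℕ → ℂ) : ℂ := limUnder atTop (bracket n g h)

/-- The first index of the infinite block of the `n`-th Jacobi matrix, on which no off-diagonal
entry vanishes: `2` for `n = 0`, `1` for `n = 1`, and `0` for `n ≥ 2`. -/
def start (n : ℕ) : ℕ := 2 - n

/-- The solution, counted from the index `start n`, of
`β_{m-1}^n y_{m-1} + β_m^n y_{m+1} = 0` for `m ≥ start n + 1`, with the first two values given. -/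
def blockSol (n : ℕ) (y₀ y₁ : ℝ) : ℕ → ℝ
  | 0 => y₀
  | 1 => y₁
  | j + 2 => -(beta n (start n + j) / beta n (start n + j + 1)) * blockSol n y₀ y₁ j

/-- `blockSol` as a sequence indexed from `0`, extended by zero below the index `start n`. -/
def sol (n : ℕ) (y₀ y₁ : ℝ) (m : ℕ) : ℝ :=
  if m < start n then 0 else blockSol n y₀ y₁ (m - start n)

theorem sol_recursion (n : ℕ) (y₀ y₁ : ℝ) (m : ℕ) (hm : start n ≤ m) :
    beta n m * sol n y₀ y₁ m + beta n (m + 1) * sol n y₀ y₁ (m + 2) = 0 := by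
  obtain ⟨j, rfl⟩ := Nat.exists_eq_add_of_le hm
  have h1 : sol n y₀ y₁ (start n + j) = blockSol n y₀ y₁ j := by simp [sol]
  have h2 : sol n y₀ y₁ (start n + j + 2) = blockSol n y₀ y₁ (j + 2) := by
    simp only [sol]
    rw [if_neg (by omega)]
    congr 1
    omega
  have h3 : beta n (start n + j + 1) ≠ 0 := by
    have h4 : (2 : ℝ) ≤ (n : ℝ) + start n := by
      have : 2 ≤ n + start n := by unfold start; omega
      exact_mod_cast this
    have h5 : (0 : ℝ) ≤ j := Nat.cast_nonneg j
    have h6 : (0 : ℝ) ≤ start n := Nat.cast_nonneg _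
    unfold beta
    push_cast
    refine mul_ne_zero (mul_ne_zero (by norm_num) (Real.sqrt_pos.2 (by linarith)).ne') ?_
    linarith
  rw [h1, h2, blockSol]
  field_simp
  ring

/-- The solution `u^n`, with initial values `1, 0`. -/
def u (n m : ℕ) : ℝ := sol n 1 0 m

/-- The solution `v^n`, with initial values `0, 1 / β`. -/
def v (n m : ℕ) : ℝ := sol n 0 (1 / beta n (start n)) m

/-- The boundary value `Γ₁^n f = [f, v^n]_∞`. -/
def Gamma1 (n : ℕ) (f : L2Plane) : ℂ := bracketInfty n (coeff n f) fun m => (v n m : ℂ)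

/-- The boundary value `Γ₂^n f = [f, u^n]_∞`. -/
def Gamma2 (n : ℕ) (f : L2Plane) : ℂ := bracketInfty n (coeff n f) fun m => (u n m : ℂ)

/-- The set of `f` in the domain of the adjoint of `T4` all of whose boundary values vanish. -/
def closureDomain : Set L2Plane :=
  {f | f ∈ T4.adjoint.domain ∧ ∀ n : ℕ, Gamma1 n (P n f) = 0 ∧ Gamma2 n (P n f) = 0}

end NonGaussian

end

noncomputable section

namespace NonGaussian

/-! On the modes the number operators act as scalars, so $\hat{\mathcal
T}_4\psi_m^n=\beta_m^n\psi_{m+1}^n+\beta_{m-1}^n\psi_{m-1}^n$, the last term being absent for $m=0$: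
the operator is a direct sum over $n$ of real symmetric Jacobi matrices. The modes form a Hilbert
basis; orthonormality comes from the ladder relations, completeness from the determinacy of
functions with exponential moments. Hence the adjoint acts on coefficients by the same matrices, on
every vector whose image is square summable (`mem_adjoint_graph_iff`). The operator is symmetric,
hence closable.

The closure is the double adjoint: $f\in D(\hat{\mathcal T}_4^*)$ lies in its domain iff $\langle
f|\hat{\mathcal T}_4^*g\rangle-\langle\hat{\mathcal T}_4^*f|g\rangle=0$ for all $g\in
D(\hat{\mathcal T}_4^*)$. By Green's formula (`sum_greenTerm`) this form equals
$\sum_n[f,g]_\infty^n$. Both $u^n$ and $v^n$ are square summable (`summable_sol_sq`), so they may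
serve as $g$: the limits defining the boundary values exist, and they vanish on the closure.
Conversely, since the Wronskian of $u^n,v^n$ is $1$,
$[f,g]_m=[f,u]_m\overline{[g,v]_m}-[f,v]_m\overline{[g,u]_m}$ for $m\ge s_n$
(`bracket_eq_of_wronskian`), so $f$ with zero boundary values annihilates the whole form. The finite
block cut off by $\beta_m^n=0$ at $m+n=1$ contributes nothing at infinity. -/

theorem inner_toL2 (f g : Sch) :
    inner ℂ (toL2 f) (toL2 g) = ∫ p : ℝ × ℝ, g p * conj (f p) :=
  SchwartzMap.inner_toL2_toL2_eq f g volume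

theorem dX_apply (f : Sch) (p : ℝ × ℝ) : dX f p = fderiv ℝ f p (1, 0) :=
  SchwartzMap.lineDerivOp_apply_eq_fderiv _ f p

theorem dY_apply (f : Sch) (p : ℝ × ℝ) : dY f p = fderiv ℝ f p (0, 1) :=
  SchwartzMap.lineDerivOp_apply_eq_fderiv _ f p

theorem hasFDerivAt_ofReal_fst (p : ℝ × ℝ) : HasFDerivAt (fun p : ℝ × ℝ => (p.1 : ℂ))
    (Complex.ofRealCLM.comp (ContinuousLinearMap.fst ℝ ℝ ℝ)) p :=
  (Complex.ofRealCLM.comp (ContinuousLinearMap.fst ℝ ℝ ℝ)).hasFDerivAt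

theorem hasFDerivAt_ofReal_snd (p : ℝ × ℝ) : HasFDerivAt (fun p : ℝ × ℝ => (p.2 : ℂ))
    (Complex.ofRealCLM.comp (ContinuousLinearMap.snd ℝ ℝ ℝ)) p :=
  (Complex.ofRealCLM.comp (ContinuousLinearMap.snd ℝ ℝ ℝ)).hasFDerivAt

theorem fderiv_mulX (f : Sch) (p w : ℝ × ℝ) :
    fderiv ℝ (mulX f) p w = (p.1 : ℂ) * fderiv ℝ f p w + (w.1 : ℂ) * f p := by
  have h : (mulX f : ℝ × ℝ → ℂ) = (fun p : ℝ × ℝ => (p.1 : ℂ)) * f := funext (mulX_apply f)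
  rw [h, ((hasFDerivAt_ofReal_fst p).mul (f.hasFDerivAt p)).fderiv]
  simp [mul_comm]

theorem fderiv_mulY (f : Sch) (p w : ℝ × ℝ) :
    fderiv ℝ (mulY f) p w = (p.2 : ℂ) * fderiv ℝ f p w + (w.2 : ℂ) * f p := by
  have h : (mulY f : ℝ × ℝ → ℂ) = (fun p : ℝ × ℝ => (p.2 : ℂ)) * f := funext (mulY_apply f)
  rw [h, ((hasFDerivAt_ofReal_snd p).mul (f.hasFDerivAt p)).fderiv]
  simp [mul_comm]

/-! ### Commutation relations -/

theorem dX_mul_mulX : dX * mulX = mulX * dX + 1 := by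
  ext f p
  simp [dX_apply, fderiv_mulX, mulX_apply]

theorem dY_mul_mulY : dY * mulY = mulY * dY + 1 := by
  ext f p
  simp [dY_apply, fderiv_mulY, mulY_apply]

theorem dX_mul_mulY : dX * mulY = mulY * dX := by
  ext f p
  simp [dX_apply, fderiv_mulY, mulY_apply]

theorem dY_mul_mulX : dY * mulX = mulX * dY := by
  ext f p
  simp [dY_apply, fderiv_mulX, mulX_apply]

theorem mulX_mul_mulY : mulX * mulY = mulY * mulX := by
  ext f p
  simp only [Module.End.mul_apply, mulX_apply, mulY_apply]
  ring

theorem dX_mul_dY : dX * dY = dY * dX := by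
  ext f p
  have h : ∀ v w : ℝ × ℝ, fderiv ℝ (fun q => fderiv ℝ f q v) p w =
      fderiv ℝ (fderiv ℝ f) p w v := fun v w => by
    have hd : DifferentiableAt ℝ (fderiv ℝ f) p :=
      ((f.smooth 2).fderiv_right (m := 1) (by norm_num)).differentiable (by norm_num) p
    rw [fderiv_clm_apply hd (differentiableAt_const v)]
    simp
  have hs : IsSymmSndFDerivAt ℝ f p :=
    (f.smooth 2).contDiffAt.isSymmSndFDerivAt (by simp)
  have e1 : (dY f : ℝ × ℝ → ℂ) = fun q => fderiv ℝ f q (0, 1) := funext (dY_apply f)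
  have e2 : (dX f : ℝ × ℝ → ℂ) = fun q => fderiv ℝ f q (1, 0) := funext (dX_apply f)
  rw [Module.End.mul_apply, Module.End.mul_apply, dX_apply, dY_apply, e1, e2, h, h]
  exact hs _ _

theorem inv_sqrt_two_mul_self : (((√2 : ℝ) : ℂ)⁻¹) * (((√2 : ℝ) : ℂ)⁻¹) = 1 / 2 := by
  rw [← mul_inv, ← Complex.ofReal_mul, Real.mul_self_sqrt (by norm_num)]
  norm_num

theorem annX_mul_creX : annX * creX = creX * annX + 1 := by
  have h : (mulX + dX) * (mulX - dX) = (mulX - dX) * (mulX + dX) + (2 : ℂ) • 1 := by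
    rw [two_smul]
    simp only [mul_sub, mul_add, sub_mul, add_mul, dX_mul_mulX]
    abel
  rw [annX, creX, smul_mul_smul_comm, smul_mul_smul_comm, inv_sqrt_two_mul_self, h, smul_add,
    smul_smul]
  norm_num

theorem annY_mul_creY : annY * creY = creY * annY + 1 := by
  have h : (mulY + dY) * (mulY - dY) = (mulY - dY) * (mulY + dY) + (2 : ℂ) • 1 := by
    rw [two_smul]
    simp only [mul_sub, mul_add, sub_mul, add_mul, dY_mul_mulY]
    abel
  rw [annY, creY, smul_mul_smul_comm, smul_mul_smul_comm, inv_sqrt_two_mul_self, h, smul_add,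
    smul_smul]
  norm_num

theorem annX_mul_creY : annX * creY = creY * annX := by
  rw [annX, creY, smul_mul_smul_comm, smul_mul_smul_comm]
  simp only [mul_sub, mul_add, sub_mul, add_mul, dX_mul_mulY, mulX_mul_mulY, dX_mul_dY, dY_mul_mulX]
  congr 1
  abel

theorem annY_mul_creX : annY * creX = creX * annY := by
  rw [annY, creX, smul_mul_smul_comm, smul_mul_smul_comm]
  simp only [mul_sub, mul_add, sub_mul, add_mul, dX_mul_mulY, mulX_mul_mulY, dX_mul_dY, dY_mul_mulX]
  congr 1
  abel

theorem creX_mul_creY : creX * creY = creY * creX := by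
  simp only [creX, creY, smul_mul_smul_comm, mul_sub, sub_mul, dX_mul_mulY,
    mulX_mul_mulY, dX_mul_dY, dY_mul_mulX]
  abel_nf

/-! ### The ladder operators are formal adjoints of each other -/

theorem inner_mulX (f g : Sch) :
    inner ℂ (toL2 f) (toL2 (mulX g)) = inner ℂ (toL2 (mulX f)) (toL2 g) := by
  simp only [inner_toL2, mulX_apply, map_mul, Complex.conj_ofReal]
  congr 1 with p
  ring

theorem inner_mulY (f g : Sch) :
    inner ℂ (toL2 f) (toL2 (mulY g)) = inner ℂ (toL2 (mulY f)) (toL2 g) := by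
  simp only [inner_toL2, mulY_apply, map_mul, Complex.conj_ofReal]
  congr 1 with p
  ring

/-- Integration by parts, applied to the real bilinear map $(a,b)\mapsto\bar a\,b$. -/
theorem inner_lineDeriv (w : ℝ × ℝ) (f g : Sch) :
    inner ℂ (toL2 f) (toL2 (∂_{w} g)) = -inner ℂ (toL2 (∂_{w} f)) (toL2 g) := by
  have h := SchwartzMap.integral_bilinear_lineDerivOp_right_eq_neg_left (μ := volume) f g
    ((ContinuousLinearMap.mul ℝ ℂ).comp (Complex.conjCLE : ℂ →L[ℝ] ℂ)) w
  simp only [inner_toL2]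
  simpa [mul_comm] using h

theorem inner_dX (f g : Sch) :
    inner ℂ (toL2 f) (toL2 (dX g)) = -inner ℂ (toL2 (dX f)) (toL2 g) :=
  inner_lineDeriv _ f g

theorem inner_dY (f g : Sch) :
    inner ℂ (toL2 f) (toL2 (dY g)) = -inner ℂ (toL2 (dY f)) (toL2 g) :=
  inner_lineDeriv _ f g

theorem inner_annX (f g : Sch) :
    inner ℂ (toL2 f) (toL2 (annX g)) = inner ℂ (toL2 (creX f)) (toL2 g) := by
  simp only [annX, creX, LinearMap.smul_apply, LinearMap.add_apply, LinearMap.sub_apply, map_smul,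
    map_add, map_sub, inner_smul_left, inner_smul_right, inner_add_right, inner_sub_left,
    inner_mulX, inner_dX, map_inv₀, Complex.conj_ofReal, ← sub_eq_add_neg]

theorem inner_annY (f g : Sch) :
    inner ℂ (toL2 f) (toL2 (annY g)) = inner ℂ (toL2 (creY f)) (toL2 g) := by
  simp only [annY, creY, LinearMap.smul_apply, LinearMap.add_apply, LinearMap.sub_apply, map_smul,
    map_add, map_sub, inner_smul_left, inner_smul_right, inner_add_right, inner_sub_left,
    inner_mulY, inner_dY, map_inv₀, Complex.conj_ofReal, ← sub_eq_add_neg]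

/-! ### The ground state -/

theorem gaussian_apply (p : ℝ × ℝ) : gaussian p = Complex.exp (gaussExponent p : ℂ) := rfl

theorem fderiv_gaussian (p w : ℝ × ℝ) :
    fderiv ℝ gaussian p w = -((p.1 * w.1 + p.2 * w.2 : ℝ) : ℂ) * gaussian p := by
  have h1 : HasFDerivAt gaussExponent
      (-(p.1 • ContinuousLinearMap.fst ℝ ℝ ℝ + p.2 • ContinuousLinearMap.snd ℝ ℝ ℝ)) p := by
    have h := ((((ContinuousLinearMap.fst ℝ ℝ ℝ).hasFDerivAt (x := p)).pow 2).add
      (((ContinuousLinearMap.snd ℝ ℝ ℝ).hasFDerivAt (x := p)).pow 2)).const_mul (-1 / 2 : ℝ)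
    refine (h.congr_fderiv ?_).congr_of_eventuallyEq (Eventually.of_forall fun q => ?_)
    · ext <;> simp <;> ring
    · simp [gaussExponent]; ring
  have h2 : HasFDerivAt gaussian _ p := (Complex.ofRealCLM.hasFDerivAt.comp p h1).cexp
  rw [h2.fderiv]
  simp [gaussian_apply]
  ring

theorem annX_groundState : annX groundState = 0 := by
  have h : (mulX + dX) gaussian = 0 := by
    ext p
    simp [mulX_apply, dX_apply, fderiv_gaussian]
  rw [groundState, map_smul, annX, LinearMap.smul_apply, h, smul_zero, smul_zero]

theorem annY_groundState : annY groundState = 0 := by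
  have h : (mulY + dY) gaussian = 0 := by
    ext p
    simp [mulY_apply, dY_apply, fderiv_gaussian]
  rw [groundState, map_smul, annY, LinearMap.smul_apply, h, smul_zero, smul_zero]

theorem inner_groundState : inner ℂ (toL2 groundState) (toL2 groundState) = 1 := by
  have h : ∀ p : ℝ × ℝ, groundState p * conj (groundState p) =
      ((Real.pi⁻¹ * (Real.exp (-1 * p.1 ^ 2) * Real.exp (-1 * p.2 ^ 2)) : ℝ) : ℂ) := fun p => by
    have e : groundState p = (((√Real.pi)⁻¹ * Real.exp (gaussExponent p) : ℝ) : ℂ) := by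
      simp [groundState, gaussian_apply]
    rw [e, Complex.conj_ofReal, ← Complex.ofReal_mul]
    congr 1
    have h1 : Real.pi⁻¹ = (√Real.pi)⁻¹ * (√Real.pi)⁻¹ := by
      rw [← mul_inv, Real.mul_self_sqrt Real.pi_pos.le]
    rw [mul_mul_mul_comm, ← h1, ← Real.exp_add, ← Real.exp_add]
    congr 2
    unfold gaussExponent
    ring
  simp only [inner_toL2, h]
  rw [integral_complex_ofReal, integral_const_mul, Measure.volume_eq_prod,
    integral_prod_mul (fun x : ℝ => Real.exp (-1 * x ^ 2)) (fun x : ℝ => Real.exp (-1 * x ^ 2)),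
    integral_gaussian, div_one, Real.mul_self_sqrt Real.pi_pos.le,
    inv_mul_cancel₀ Real.pi_ne_zero, Complex.ofReal_one]

/-! ### Ladder operators on modes -/

theorem sqrt_factorial_succ (m n : ℕ) :
    √(((m + 1).factorial : ℝ) * (n.factorial : ℝ)) =
      √((m : ℝ) + 1) * √((m.factorial : ℝ) * (n.factorial : ℝ)) := by
  rw [← Real.sqrt_mul (by positivity), Nat.factorial_succ]
  push_cast
  rw [mul_assoc]

theorem ofReal_sqrt_succ_ne_zero (m : ℕ) : ((√((m : ℝ) + 1) : ℝ) : ℂ) ≠ 0 := by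
  have : 0 < √((m : ℝ) + 1) := Real.sqrt_pos.2 (by positivity)
  exact_mod_cast this.ne'

theorem ofReal_sqrt_mul_self (m : ℕ) :
    ((√((m : ℝ) + 1) : ℝ) : ℂ) * ((√((m : ℝ) + 1) : ℝ) : ℂ) = (m : ℂ) + 1 := by
  rw [← Complex.ofReal_mul, Real.mul_self_sqrt (by positivity)]
  push_cast
  rfl

theorem creX_modeFun (m n : ℕ) :
    creX (modeFun m n) = ((√((m : ℝ) + 1) : ℝ) : ℂ) • modeFun (m + 1) n := by
  have h : creX ((creX ^ m * creY ^ n) groundState) =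
      (creX ^ (m + 1) * creY ^ n) groundState := by
    rw [pow_succ', mul_assoc]
    rfl
  rw [modeFun, modeFun, map_smul, smul_smul, h, sqrt_factorial_succ, Complex.ofReal_mul, mul_inv,
    mul_inv_cancel_left₀ (ofReal_sqrt_succ_ne_zero m)]

theorem creY_modeFun (m n : ℕ) :
    creY (modeFun m n) = ((√((n : ℝ) + 1) : ℝ) : ℂ) • modeFun m (n + 1) := by
  have h : creY ((creX ^ m * creY ^ n) groundState) =
      (creX ^ m * creY ^ (n + 1)) groundState := by
    have hc : creY * creX ^ m = creX ^ m * creY :=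
      ((show Commute creY creX from creX_mul_creY.symm).pow_right m).eq
    rw [pow_succ', ← mul_assoc, ← hc, mul_assoc]
    rfl
  rw [modeFun, modeFun, map_smul, smul_smul, h, mul_comm (m.factorial : ℝ) ((n + 1).factorial : ℝ),
    sqrt_factorial_succ, Complex.ofReal_mul, mul_inv,
    mul_inv_cancel_left₀ (ofReal_sqrt_succ_ne_zero n), mul_comm (m.factorial : ℝ)]

theorem annX_modeFun_zero (n : ℕ) : annX (modeFun 0 n) = 0 := by
  have hc : annX * creY ^ n = creY ^ n * annX :=
    ((show Commute annX creY from annX_mul_creY).pow_right n).eq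
  rw [modeFun, map_smul, pow_zero, one_mul, ← Module.End.mul_apply, hc, Module.End.mul_apply,
    annX_groundState, map_zero, smul_zero]

theorem annY_modeFun_zero (m : ℕ) : annY (modeFun m 0) = 0 := by
  have hc : annY * creX ^ m = creX ^ m * annY :=
    ((show Commute annY creX from annY_mul_creX).pow_right m).eq
  rw [modeFun, map_smul, pow_zero, mul_one, ← Module.End.mul_apply, hc, Module.End.mul_apply,
    annY_groundState, map_zero, smul_zero]

theorem annX_modeFun_succ (m n : ℕ) :
    annX (modeFun (m + 1) n) = ((√((m : ℝ) + 1) : ℝ) : ℂ) • modeFun m n := by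
  -- The number eigenvalue $m$ and the commutator give $a_xa_x^\dagger\psi_m=(m+1)\psi_m$; one
  -- factor $\sqrt{m+1}$ is then cancelled.
  have key : ∀ m, creX (annX (modeFun m n)) = (m : ℂ) • modeFun m n →
      annX (modeFun (m + 1) n) = ((√((m : ℝ) + 1) : ℝ) : ℂ) • modeFun m n := fun m h => by
    have h1 : annX (creX (modeFun m n)) = ((m : ℂ) + 1) • modeFun m n := by
      rw [← Module.End.mul_apply, annX_mul_creX, LinearMap.add_apply, Module.End.mul_apply, h,
        add_smul, one_smul, Module.End.one_apply]
    rw [creX_modeFun, map_smul, ← ofReal_sqrt_mul_self, mul_smul] at h1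
    exact smul_right_injective _ (ofReal_sqrt_succ_ne_zero m) h1
  induction m with
  | zero => exact key 0 (by rw [annX_modeFun_zero]; simp)
  | succ m ih =>
    refine key (m + 1) ?_
    rw [ih, map_smul, creX_modeFun, smul_smul, ofReal_sqrt_mul_self]
    push_cast
    rfl

theorem annY_modeFun_succ (m n : ℕ) :
    annY (modeFun m (n + 1)) = ((√((n : ℝ) + 1) : ℝ) : ℂ) • modeFun m n := by
  have key : ∀ n, creY (annY (modeFun m n)) = (n : ℂ) • modeFun m n →
      annY (modeFun m (n + 1)) = ((√((n : ℝ) + 1) : ℝ) : ℂ) • modeFun m n := fun n h => by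
    have h1 : annY (creY (modeFun m n)) = ((n : ℂ) + 1) • modeFun m n := by
      rw [← Module.End.mul_apply, annY_mul_creY, LinearMap.add_apply, Module.End.mul_apply, h,
        add_smul, one_smul, Module.End.one_apply]
    rw [creY_modeFun, map_smul, ← ofReal_sqrt_mul_self, mul_smul] at h1
    exact smul_right_injective _ (ofReal_sqrt_succ_ne_zero n) h1
  induction n with
  | zero => exact key 0 (by rw [annY_modeFun_zero]; simp)
  | succ n ih =>
    refine key (n + 1) ?_
    rw [ih, map_smul, creY_modeFun, smul_smul, ofReal_sqrt_mul_self]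
    push_cast
    rfl

theorem creY_annY_modeFun (m n : ℕ) : creY (annY (modeFun m n)) = (n : ℂ) • modeFun m n := by
  cases n with
  | zero => rw [annY_modeFun_zero]; simp
  | succ n =>
    rw [annY_modeFun_succ, map_smul, creY_modeFun, smul_smul, ofReal_sqrt_mul_self]
    push_cast
    rfl

theorem creX_annX_modeFun (m n : ℕ) : creX (annX (modeFun m n)) = (m : ℂ) • modeFun m n := by
  cases m with
  | zero => rw [annX_modeFun_zero]; simp
  | succ m =>
    rw [annX_modeFun_succ, map_smul, creX_modeFun, smul_smul, ofReal_sqrt_mul_self]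
    push_cast
    rfl

/-! ### The generator on modes -/

/-- Every cubic term is a number operator times a single ladder operator. The shift from $1$ to $2$
arises because $a_x^\dagger a_x$ acts after $a_x$ has lowered $m$; this shift makes the matrix
symmetric. -/
theorem t4Expr_modeFun (m n : ℕ) : t4Expr (modeFun m n) =
    ((1 / 2 : ℂ) * (1 - m - n)) • creX (modeFun m n) +
      ((1 / 2 : ℂ) * (2 - m - n)) • annX (modeFun m n) := by
  have h1 : creX (annX (annX (modeFun m n))) = ((m : ℂ) - 1) • annX (modeFun m n) := by
    have h : creX * annX = annX * creX - 1 := by rw [annX_mul_creX, add_sub_cancel_right]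
    rw [← Module.End.mul_apply creX annX, h, LinearMap.sub_apply, Module.End.mul_apply,
      creX_annX_modeFun, map_smul, Module.End.one_apply, sub_smul, one_smul]
  simp only [t4Expr, LinearMap.smul_apply, LinearMap.sub_apply, LinearMap.add_apply,
    Module.End.mul_apply, creY_annY_modeFun, creX_annX_modeFun, h1, map_smul]
  module

theorem t4Expr_modeFun_zero (n : ℕ) :
    t4Expr (modeFun 0 n) = (beta n 0 : ℂ) • modeFun 1 n := by
  rw [t4Expr_modeFun, annX_modeFun_zero, creX_modeFun, smul_smul, smul_zero, add_zero, beta]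
  congr 1
  push_cast
  ring

theorem t4Expr_modeFun_succ (m n : ℕ) : t4Expr (modeFun (m + 1) n) =
    (beta n (m + 1) : ℂ) • modeFun (m + 2) n + (beta n m : ℂ) • modeFun m n := by
  rw [t4Expr_modeFun, annX_modeFun_succ, creX_modeFun, smul_smul, smul_smul, beta, beta]
  congr 2 <;> push_cast <;> ring

/-! ### Orthonormality of the modes -/

theorem inner_mode_zero_zero : inner ℂ (mode 0 0) (mode 0 0) = 1 := by
  simpa [mode, modeFun] using inner_groundState

theorem inner_mode_succ_succ_left (m n m' n' : ℕ) :
    ((√((m : ℝ) + 1) : ℝ) : ℂ) * inner ℂ (mode (m + 1) n) (mode (m' + 1) n') =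
      ((√((m' : ℝ) + 1) : ℝ) : ℂ) * inner ℂ (mode m n) (mode m' n') := by
  have h := inner_annX (modeFun m n) (modeFun (m' + 1) n')
  rw [annX_modeFun_succ, creX_modeFun, map_smul, map_smul, inner_smul_left, inner_smul_right,
    Complex.conj_ofReal] at h
  exact h.symm

theorem inner_mode_succ_zero_left (m n n' : ℕ) :
    inner ℂ (mode (m + 1) n) (mode 0 n') = 0 := by
  have h := inner_annX (modeFun m n) (modeFun 0 n')
  rw [annX_modeFun_zero, creX_modeFun, map_zero, map_smul, inner_smul_left, inner_zero_right,
    Complex.conj_ofReal] at h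
  exact (mul_eq_zero.1 h.symm).resolve_left (ofReal_sqrt_succ_ne_zero m)

theorem inner_mode_succ_succ_right (m n m' n' : ℕ) :
    ((√((n : ℝ) + 1) : ℝ) : ℂ) * inner ℂ (mode m (n + 1)) (mode m' (n' + 1)) =
      ((√((n' : ℝ) + 1) : ℝ) : ℂ) * inner ℂ (mode m n) (mode m' n') := by
  have h := inner_annY (modeFun m n) (modeFun m' (n' + 1))
  rw [annY_modeFun_succ, creY_modeFun, map_smul, map_smul, inner_smul_left, inner_smul_right,
    Complex.conj_ofReal] at h
  exact h.symm

theorem inner_mode_succ_zero_right (m n m' : ℕ) :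
    inner ℂ (mode m (n + 1)) (mode m' 0) = 0 := by
  have h := inner_annY (modeFun m n) (modeFun m' 0)
  rw [annY_modeFun_zero, creY_modeFun, map_zero, map_smul, inner_smul_left, inner_zero_right,
    Complex.conj_ofReal] at h
  exact (mul_eq_zero.1 h.symm).resolve_left (ofReal_sqrt_succ_ne_zero n)

/-- Both indices are lowered together until one reaches zero, where the annihilation operator kills
the mode. -/
theorem inner_mode_of_ne_left {m m' : ℕ} (h : m ≠ m') (n n' : ℕ) :
    inner ℂ (mode m n) (mode m' n') = 0 := by
  induction m generalizing m' with
  | zero =>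
    obtain ⟨k, rfl⟩ := Nat.exists_eq_succ_of_ne_zero h.symm
    rw [← inner_conj_symm, inner_mode_succ_zero_left, map_zero]
  | succ m ih =>
    cases m' with
    | zero => exact inner_mode_succ_zero_left m n n'
    | succ m' =>
      have h1 := inner_mode_succ_succ_left m n m' n'
      rw [ih (by omega), mul_zero] at h1
      exact (mul_eq_zero.1 h1).resolve_left (ofReal_sqrt_succ_ne_zero m)

theorem inner_mode_of_ne_right {n n' : ℕ} (h : n ≠ n') (m m' : ℕ) :
    inner ℂ (mode m n) (mode m' n') = 0 := by
  induction n generalizing n' with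
  | zero =>
    obtain ⟨k, rfl⟩ := Nat.exists_eq_succ_of_ne_zero h.symm
    rw [← inner_conj_symm, inner_mode_succ_zero_right, map_zero]
  | succ n ih =>
    cases n' with
    | zero => exact inner_mode_succ_zero_right m n m'
    | succ n' =>
      have h1 := inner_mode_succ_succ_right m n m' n'
      rw [ih (by omega), mul_zero] at h1
      exact (mul_eq_zero.1 h1).resolve_left (ofReal_sqrt_succ_ne_zero n)

theorem inner_mode_self (m n : ℕ) : inner ℂ (mode m n) (mode m n) = 1 := by
  induction m with
  | zero =>
    induction n with
    | zero => exact inner_mode_zero_zero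
    | succ n ih =>
      have h := inner_mode_succ_succ_right 0 n 0 n
      rw [ih] at h
      exact mul_left_cancel₀ (ofReal_sqrt_succ_ne_zero n) h
  | succ m ih =>
    have h := inner_mode_succ_succ_left m n m n
    rw [ih] at h
    exact mul_left_cancel₀ (ofReal_sqrt_succ_ne_zero m) h

theorem orthonormal_mode : Orthonormal ℂ fun k : ℕ × ℕ => mode k.1 k.2 := by
  rw [orthonormal_iff_ite]
  rintro ⟨m, n⟩ ⟨m', n'⟩
  split_ifs with h
  · obtain ⟨rfl, rfl⟩ := Prod.mk.inj h
    exact inner_mode_self m n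
  · by_cases hm : m = m'
    · exact inner_mode_of_ne_right (fun hn => h (Prod.ext hm hn)) m m'
    · exact inner_mode_of_ne_left hm n n'

/-! ### Determinacy of functions with exponential moments -/

section Determinacy

variable {E : Type*} [NormedAddCommGroup E] [NormedSpace ℝ E] [MeasurableSpace E] [BorelSpace E]
  [SecondCountableTopology E] [CompleteSpace E] {μ : Measure E}

/-- The positive and negative parts of `h` are densities of finite measures with equal
characteristic functions, so they agree; having disjoint supports, both vanish. -/
theorem ae_eq_zero_of_integral_cexp_mul_eq_zero {h : E → ℝ} (hh : Integrable h μ)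
    (h0 : ∀ L : StrongDual ℝ E, ∫ p, Complex.exp (L p * Complex.I) * (h p : ℂ) ∂μ = 0) :
    h =ᵐ[μ] 0 := by
  have hm : AEMeasurable h μ := hh.aestronglyMeasurable.aemeasurable
  have hfin := isFiniteMeasure_withDensity_ofReal hh.hasFiniteIntegral
  have hfin' := isFiniteMeasure_withDensity_ofReal hh.neg.hasFiniteIntegral
  have key : μ.withDensity (fun p => ENNReal.ofReal (h p)) =
      μ.withDensity (fun p => ENNReal.ofReal ((-h) p)) := by
    refine Measure.ext_of_charFunDual (funext fun L => ?_)
    have hi : ∀ {g : E → ℝ}, Integrable g μ →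
        Integrable (fun p => (ENNReal.ofReal (g p)).toReal • Complex.exp (L p * Complex.I)) μ := by
      intro g hg
      have h1 : Integrable (fun p => ((ENNReal.ofReal (g p)).toReal : ℂ)) μ := by
        simp only [ENNReal.toReal_ofReal']
        exact hg.pos_part.ofReal
      have h2 : AEStronglyMeasurable (fun p => Complex.exp (L p * Complex.I)) μ := by
        apply Continuous.aestronglyMeasurable
        fun_prop
      refine (h1.mul_bdd (c := 1) h2 (Eventually.of_forall fun p => ?_)).congr
        (Eventually.of_forall fun p => ?_)
      · rw [Complex.norm_exp_ofReal_mul_I]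
      · simp
    rw [charFunDual_apply, charFunDual_apply,
      integral_withDensity_eq_integral_toReal_smul₀ hm.ennreal_ofReal (by simp),
      integral_withDensity_eq_integral_toReal_smul₀ hm.neg.ennreal_ofReal (by simp),
      ← sub_eq_zero, ← integral_sub (hi hh) (hi hh.neg), ← h0 L]
    congr 1 with p
    rw [← sub_smul, ENNReal.toReal_ofReal', ENNReal.toReal_ofReal', Pi.neg_apply,
      Complex.real_smul, mul_comm]
    congr 2
    exact max_zero_sub_eq_self (h p)
  have h2 := (withDensity_eq_iff hm.ennreal_ofReal hm.neg.ennreal_ofReal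
    (by simpa using (measure_lt_top (μ.withDensity fun p => ENNReal.ofReal (h p)) Set.univ).ne)).1 key
  filter_upwards [h2] with p hp
  rcases le_total (h p) 0 with hl | hl
  · rw [ENNReal.ofReal_of_nonpos hl, Pi.neg_apply] at hp
    exact le_antisymm hl (neg_nonpos.1 (ENNReal.ofReal_eq_zero.1 hp.symm))
  · rw [Pi.neg_apply, ENNReal.ofReal_of_nonpos (neg_nonpos.2 hl)] at hp
    exact le_antisymm (ENNReal.ofReal_eq_zero.1 hp) hl

/-- The series of $e^{iL}h$ may be integrated termwise, since $e^{|L|}|h|$ is the sum of the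
absolute values; each term is a moment. -/
theorem ae_eq_zero_of_moments_eq_zero {h : E → ℝ} (hm : AEStronglyMeasurable h μ)
    (hh : ∀ L : StrongDual ℝ E, Integrable (fun p => Real.exp |L p| * h p) μ)
    (h0 : ∀ (L : StrongDual ℝ E) (k : ℕ), ∫ p, L p ^ k * h p ∂μ = 0) : h =ᵐ[μ] 0 := by
  refine ae_eq_zero_of_integral_cexp_mul_eq_zero (by simpa using hh 0) fun L => ?_
  have hs : ∀ p, HasSum (fun k : ℕ => |L p| ^ k / k.factorial * |h p|) (Real.exp |L p| * |h p|) :=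
    fun p => by
      rw [Real.exp_eq_exp_ℝ]
      exact (NormedSpace.expSeries_div_hasSum_exp |L p|).mul_right _
  have key := hasSum_integral_of_dominated_convergence (μ := μ)
    (F := fun (k : ℕ) p => (L p * Complex.I : ℂ) ^ k / k.factorial * (h p : ℂ))
    (f := fun p => Complex.exp (L p * Complex.I) * (h p : ℂ))
    (fun (k : ℕ) p => |L p| ^ k / k.factorial * |h p|) (fun k => ?_)
    (fun k => Eventually.of_forall fun p => ?_)
    (Eventually.of_forall fun p => (hs p).summable) ?_ (Eventually.of_forall fun p => ?_)
  · refine key.unique ?_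
    convert hasSum_zero with k
    have e : (fun p => (L p * Complex.I : ℂ) ^ k / k.factorial * (h p : ℂ)) =
        fun p => (Complex.I ^ k / k.factorial : ℂ) * ((L p ^ k * h p : ℝ) : ℂ) := by
      funext p
      push_cast
      ring
    rw [e, integral_const_mul, integral_complex_ofReal, h0, Complex.ofReal_zero, mul_zero]
  · refine AEStronglyMeasurable.mul (Continuous.aestronglyMeasurable (by fun_prop)) ?_
    exact Complex.continuous_ofReal.comp_aestronglyMeasurable hm
  · simp
  · simp only [fun p => (hs p).tsum_eq]
    refine (hh L).norm.congr (Eventually.of_forall fun p => ?_)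
    simp
  · rw [Complex.exp_eq_exp_ℂ]
    exact (NormedSpace.expSeries_div_hasSum_exp (L p * Complex.I : ℂ)).mul_right _

end Determinacy

/-! ### Completeness of the modes -/

theorem memLp_exp_abs_mul_gauss (L : StrongDual ℝ (ℝ × ℝ)) :
    MemLp (fun p => Real.exp |L p| * Real.exp (gaussExponent p)) 2
      (volume : Measure (ℝ × ℝ)) := by
  have hc : Continuous gaussExponent := (gaussExponent_contDiff (k := 0)).continuous
  have hm : AEStronglyMeasurable (fun p => Real.exp |L p| * Real.exp (gaussExponent p))
      (volume : Measure (ℝ × ℝ)) := Continuous.aestronglyMeasurable (by fun_prop)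
  rw [memLp_two_iff_integrable_sq hm]
  -- The constant comes from $2\|L\|\|p\|\le2\|L\|^2+\frac12\|p\|^2$, which uses up half of the
  -- squared Gaussian's exponent.
  have hi : Integrable (fun p : ℝ × ℝ => Real.exp (2 * ‖L‖ ^ 2) *
      (Real.exp (-(1 / 2) * p.1 ^ 2) * Real.exp (-(1 / 2) * p.2 ^ 2))) volume :=
    ((integrable_exp_neg_mul_sq (b := 1 / 2) (by norm_num)).mul_prod
      (integrable_exp_neg_mul_sq (b := 1 / 2) (by norm_num))).const_mul _
  refine hi.mono' (hm.pow 2) (Eventually.of_forall fun p => ?_)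
  rw [Real.norm_eq_abs, abs_of_nonneg (by positivity), ← Real.exp_add, ← Real.exp_add,
    ← Real.exp_add, ← Real.exp_nat_mul, Real.exp_le_exp]
  have h1 : |L p| ≤ ‖L‖ * ‖p‖ := L.le_opNorm p
  have h2 : ‖p‖ ^ 2 ≤ p.1 ^ 2 + p.2 ^ 2 := by
    rcases max_choice ‖p.1‖ ‖p.2‖ with h | h <;> rw [Prod.norm_def, h, Real.norm_eq_abs, sq_abs]
    · nlinarith [sq_nonneg p.2]
    · nlinarith [sq_nonneg p.1]
  unfold gaussExponent
  push_cast
  nlinarith [sq_nonneg (2 * ‖L‖ - ‖p‖)]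

theorem modeFun_mem_modeSpan (m n : ℕ) : modeFun m n ∈ modeSpan :=
  Submodule.subset_span ⟨(m, n), rfl⟩

theorem map_mem_modeSpan (A : Module.End ℂ Sch)
    (hA : ∀ m n, A (modeFun m n) ∈ modeSpan) {f : Sch} (hf : f ∈ modeSpan) : A f ∈ modeSpan := by
  have : modeSpan ≤ modeSpan.comap A := by
    rw [modeSpan, Submodule.span_le]
    rintro _ ⟨k, rfl⟩
    exact hA k.1 k.2
  exact this hf

theorem mulX_mem_modeSpan {f : Sch} (hf : f ∈ modeSpan) : mulX f ∈ modeSpan := by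
  have h : mulX = ((√2 : ℝ) : ℂ)⁻¹ • (creX + annX) := by
    rw [creX, annX, ← smul_add, smul_smul, inv_sqrt_two_mul_self]
    module
  refine map_mem_modeSpan mulX (fun m n => ?_) hf
  rw [h, LinearMap.smul_apply, LinearMap.add_apply]
  refine modeSpan.smul_mem _ (modeSpan.add_mem ?_ ?_)
  · rw [creX_modeFun]
    exact modeSpan.smul_mem _ (modeFun_mem_modeSpan _ _)
  · cases m with
    | zero => rw [annX_modeFun_zero]; exact modeSpan.zero_mem
    | succ m => rw [annX_modeFun_succ]; exact modeSpan.smul_mem _ (modeFun_mem_modeSpan _ _)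

theorem mulY_mem_modeSpan {f : Sch} (hf : f ∈ modeSpan) : mulY f ∈ modeSpan := by
  have h : mulY = ((√2 : ℝ) : ℂ)⁻¹ • (creY + annY) := by
    rw [creY, annY, ← smul_add, smul_smul, inv_sqrt_two_mul_self]
    module
  refine map_mem_modeSpan mulY (fun m n => ?_) hf
  rw [h, LinearMap.smul_apply, LinearMap.add_apply]
  refine modeSpan.smul_mem _ (modeSpan.add_mem ?_ ?_)
  · rw [creY_modeFun]
    exact modeSpan.smul_mem _ (modeFun_mem_modeSpan _ _)
  · cases n with
    | zero => rw [annY_modeFun_zero]; exact modeSpan.zero_mem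
    | succ n => rw [annY_modeFun_succ]; exact modeSpan.smul_mem _ (modeFun_mem_modeSpan _ _)

theorem gaussian_mem_modeSpan : gaussian ∈ modeSpan := by
  have h0 : ((√Real.pi : ℝ) : ℂ) ≠ 0 := by
    exact_mod_cast (Real.sqrt_pos.2 Real.pi_pos).ne'
  have h : gaussian = ((√Real.pi : ℝ) : ℂ) • modeFun 0 0 := by
    simp [modeFun, groundState, smul_smul, h0]
  rw [h]
  exact modeSpan.smul_mem _ (modeFun_mem_modeSpan _ _)

/-- The span is stable under multiplication by $x$ and $y$ because each is a sum of ladder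
operators. Powers of linear forms are the only polynomials the moment argument needs. -/
theorem exists_mem_modeSpan_eq_pow_mul (L : StrongDual ℝ (ℝ × ℝ)) (k : ℕ) :
    ∃ g ∈ modeSpan, ∀ p, g p = ((L p ^ k * Real.exp (gaussExponent p) : ℝ) : ℂ) := by
  induction k with
  | zero => exact ⟨gaussian, gaussian_mem_modeSpan, fun p => by simp [gaussian_apply]⟩
  | succ k ih =>
    obtain ⟨g, hg, hp⟩ := ih
    refine ⟨((L (1, 0) : ℝ) : ℂ) • mulX g + ((L (0, 1) : ℝ) : ℂ) • mulY g,
      modeSpan.add_mem (modeSpan.smul_mem _ (mulX_mem_modeSpan hg))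
        (modeSpan.smul_mem _ (mulY_mem_modeSpan hg)), fun p => ?_⟩
    have hL : L p = p.1 * L (1, 0) + p.2 * L (0, 1) := by
      have e : p = p.1 • ((1, 0) : ℝ × ℝ) + p.2 • ((0, 1) : ℝ × ℝ) := by ext <;> simp
      conv_lhs => rw [e]
      rw [map_add, map_smul, map_smul, smul_eq_mul, smul_eq_mul]
    rw [add_apply, smul_apply, smul_apply, mulX_apply,
      mulY_apply, hp, pow_succ, hL]
    push_cast
    simp only [smul_eq_mul]
    ring

theorem ae_eq_zero_of_gauss_moments {r : ℝ × ℝ → ℝ} (hr : MemLp r 2 volume)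
    (h0 : ∀ (L : StrongDual ℝ (ℝ × ℝ)) (k : ℕ),
      ∫ p, L p ^ k * Real.exp (gaussExponent p) * r p = 0) : r =ᵐ[volume] 0 := by
  have hc : Continuous gaussExponent := (gaussExponent_contDiff (k := 0)).continuous
  have h := ae_eq_zero_of_moments_eq_zero (μ := volume)
    (h := fun p => Real.exp (gaussExponent p) * r p)
    ((Continuous.aestronglyMeasurable (by fun_prop)).mul hr.aestronglyMeasurable)
    (fun L => by
      refine ((memLp_exp_abs_mul_gauss L).integrable_mul hr).congr
        (Eventually.of_forall fun p => ?_)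
      simp [mul_assoc])
    (fun L k => by simpa only [mul_assoc] using h0 L k)
  filter_upwards [h] with p hp
  exact (mul_eq_zero.1 hp).resolve_left (Real.exp_pos _).ne'

/-- The real and imaginary parts of `f`, times the Gaussian, have exponential moments and all their
moments vanish. -/
theorem eq_zero_of_inner_mode_eq_zero {f : L2Plane} (hf : ∀ m n, inner ℂ (mode m n) f = 0) :
    f = 0 := by
  have h1 : ∀ g ∈ modeSpan, inner ℂ (toL2 g) f = 0 := fun g hg => by
    induction hg using Submodule.span_induction with
    | mem g h => obtain ⟨k, rfl⟩ := h; exact hf k.1 k.2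
    | zero => rw [map_zero, inner_zero_left]
    | add g g' _ _ h h' => rw [map_add, inner_add_left, h, h', add_zero]
    | smul c g _ h => rw [map_smul, inner_smul_left, h, mul_zero]
  have hmem : MemLp f 2 volume := Lp.memLp f
  have h2 : ∀ (L : StrongDual ℝ (ℝ × ℝ)) (k : ℕ),
      ∫ p, ((L p ^ k * Real.exp (gaussExponent p) : ℝ) : ℂ) * f p = 0 ∧
      Integrable (fun p => ((L p ^ k * Real.exp (gaussExponent p) : ℝ) : ℂ) * f p) := fun L k => by
    obtain ⟨g, hg, hgp⟩ := exists_mem_modeSpan_eq_pow_mul L k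
    constructor
    · rw [← h1 g hg, L2.inner_def]
      refine integral_congr_ae ?_
      filter_upwards [SchwartzMap.coeFn_toLp g 2 (volume : Measure (ℝ × ℝ))] with p hp
      have hp' : (toL2 g : ℝ × ℝ → ℂ) p = g p := hp
      rw [hp', hgp, RCLike.inner_apply, Complex.conj_ofReal, mul_comm]
    · simp only [← hgp]
      exact MemLp.integrable_mul (SchwartzMap.memLp g 2 volume) hmem
  have hre : (fun p => (f p).re) =ᵐ[volume] 0 := by
    refine ae_eq_zero_of_gauss_moments hmem.re fun L k => ?_
    have h := integral_re (h2 L k).2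
    rw [(h2 L k).1, map_zero] at h
    rw [← h]
    congr 1 with p
    exact (Complex.re_ofReal_mul _ _).symm
  have him : (fun p => (f p).im) =ᵐ[volume] 0 := by
    refine ae_eq_zero_of_gauss_moments hmem.im fun L k => ?_
    have h := integral_im (h2 L k).2
    rw [(h2 L k).1, map_zero] at h
    rw [← h]
    congr 1 with p
    exact (Complex.im_ofReal_mul _ _).symm
  rw [Lp.eq_zero_iff_ae_eq_zero]
  filter_upwards [hre, him] with p h3 h4
  exact Complex.ext h3 h4

theorem orthogonal_span_mode :
    (Submodule.span ℂ (Set.range fun k : ℕ × ℕ => mode k.1 k.2))ᗮ = ⊥ := by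
  rw [eq_bot_iff]
  intro f hf
  exact eq_zero_of_inner_mode_eq_zero fun m n =>
    (Submodule.mem_orthogonal _ f).1 hf _ (Submodule.subset_span ⟨(m, n), rfl⟩)

/-- The modes as a Hilbert basis. -/
def modeBasis : HilbertBasis (ℕ × ℕ) ℂ L2Plane :=
  HilbertBasis.mkOfOrthogonalEqBot orthonormal_mode orthogonal_span_mode

theorem modeBasis_apply (k : ℕ × ℕ) : modeBasis k = mode k.1 k.2 := by
  rw [modeBasis, HilbertBasis.coe_mkOfOrthogonalEqBot]

/-! ### The Jacobi matrices and Green's formula -/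

/-- The action of the `n`-th Jacobi matrix on sequences. -/
def jacobi (n : ℕ) (y : ℕ → ℂ) : ℕ → ℂ
  | 0 => (beta n 0 : ℂ) * y 1
  | m + 1 => (beta n (m + 1) : ℂ) * y (m + 2) + (beta n m : ℂ) * y m

/-- The summand of Green's formula for the `n`-th Jacobi matrix. -/
def greenTerm (n : ℕ) (g h : ℕ → ℂ) (m : ℕ) : ℂ :=
  g m * conj (jacobi n h m) - jacobi n g m * conj (h m)

/-- Discrete Green formula: by symmetry of the matrix the sum telescopes, leaving only the coupling
between `M` and `M + 1`. -/
theorem sum_greenTerm (n : ℕ) (g h : ℕ → ℂ) (M : ℕ) :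
    ∑ m ∈ Finset.range (M + 1), greenTerm n g h m = bracket n g h M := by
  induction M with
  | zero =>
    simp only [zero_add, Finset.sum_range_one, greenTerm, jacobi, bracket, map_mul,
      Complex.conj_ofReal]
    ring
  | succ M ih =>
    rw [Finset.sum_range_succ, ih]
    simp only [greenTerm, jacobi, bracket, map_mul, map_add, Complex.conj_ofReal]
    ring

theorem tendsto_bracket {n : ℕ} {g h : ℕ → ℂ} {l : ℂ} (hs : HasSum (greenTerm n g h) l) :
    Tendsto (bracket n g h) atTop (𝓝 l) := by
  have := hs.tendsto_sum_nat.comp (tendsto_add_atTop_nat 1)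
  exact this.congr fun M => sum_greenTerm n g h M

/-! ### The distinguished solutions -/

theorem beta_eq_zero {n m : ℕ} (h : m + 1 = start n) : beta n m = 0 := by
  have h1 : m + n = 1 := by unfold start at h; omega
  have h2 : (m : ℝ) + n = 1 := by exact_mod_cast h1
  rw [beta, sub_sub, h2, sub_self, mul_zero]

theorem beta_ne_zero {n m : ℕ} (h : start n ≤ m) : beta n m ≠ 0 := by
  have h1 : 2 ≤ m + n := by unfold start at h; omega
  have h2 : (2 : ℝ) ≤ m + n := by exact_mod_cast h1
  unfold beta
  refine mul_ne_zero (mul_ne_zero (by norm_num) (Real.sqrt_pos.2 (by positivity)).ne') ?_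
  linarith

theorem sol_of_lt {n m : ℕ} (h : m < start n) (y₀ y₁ : ℝ) : sol n y₀ y₁ m = 0 := if_pos h

theorem sol_start (n : ℕ) (y₀ y₁ : ℝ) : sol n y₀ y₁ (start n) = y₀ := by
  simp [sol, blockSol]

theorem sol_start_succ (n : ℕ) (y₀ y₁ : ℝ) : sol n y₀ y₁ (start n + 1) = y₁ := by
  simp [sol, blockSol]

/-- The recursion starts one index above `start n`, so a defect survives only there. Extension by
zero creates none, because the entry coupling to the index below vanishes. -/
theorem jacobi_sol (n : ℕ) (y₀ y₁ : ℝ) (m : ℕ) :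
    jacobi n (fun m => (sol n y₀ y₁ m : ℂ)) m =
      if m = start n then ((beta n (start n) * y₁ : ℝ) : ℂ) else 0 := by
  cases m with
  | zero =>
    rw [jacobi]
    split_ifs with h
    · have := sol_start_succ n y₀ y₁
      rw [← h, zero_add] at this
      rw [this, ← h, Complex.ofReal_mul]
    · by_cases h1 : 0 + 1 = start n
      · rw [beta_eq_zero h1, Complex.ofReal_zero, zero_mul]
      · rw [sol_of_lt (by omega), Complex.ofReal_zero, mul_zero]
  | succ m =>
    rw [jacobi]
    split_ifs with h
    · rw [beta_eq_zero h, Complex.ofReal_zero, zero_mul, add_zero, ← Complex.ofReal_mul]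
      have := sol_start_succ n y₀ y₁
      rw [← h] at this
      rw [this, h]
    · by_cases h1 : start n ≤ m
      · rw [add_comm]
        exact_mod_cast sol_recursion n y₀ y₁ m h1
      · rw [sol_of_lt (m := m) (by omega), Complex.ofReal_zero, mul_zero, add_zero]
        by_cases h2 : m + 1 + 1 = start n
        · rw [beta_eq_zero h2, Complex.ofReal_zero, zero_mul]
        · rw [sol_of_lt (by omega), Complex.ofReal_zero, mul_zero]

/-- A telescoping substitute for decay asymptotics. With $k=m+n$ the recursion gives
$y_{m+2}^2/y_m^2=\frac{(m+1)(k-1)^2}{(m+2)k^2}$ when $y_m\ne0$, small enough for the weighted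
squares $k\,y_m^2$ to drop by at least $y_m^2$. -/
theorem sol_sq_le (n : ℕ) (y₀ y₁ : ℝ) {m : ℕ} (hm : start n ≤ m) :
    sol n y₀ y₁ m ^ 2 ≤ ((m : ℝ) + n) * sol n y₀ y₁ m ^ 2 -
      (((m + 2 : ℕ) : ℝ) + n) * sol n y₀ y₁ (m + 2) ^ 2 := by
  have hr := sol_recursion n y₀ y₁ m hm
  have h1 : 2 ≤ m + n := by unfold start at hm; omega
  have h2 : (2 : ℝ) ≤ m + n := by exact_mod_cast h1
  set a := sol n y₀ y₁ m
  set b := sol n y₀ y₁ (m + 2)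
  have hn : (0 : ℝ) ≤ n := Nat.cast_nonneg n
  obtain ⟨k, hk⟩ : ∃ k : ℝ, k = m + n := ⟨_, rfl⟩
  have hm0 : (0 : ℝ) ≤ m := Nat.cast_nonneg m
  have h3 : ((m : ℝ) + 1) * (k - 1) ^ 2 * a ^ 2 = ((m : ℝ) + 2) * k ^ 2 * b ^ 2 := by
    have e1 : beta n m ^ 2 = 1 / 4 * ((m : ℝ) + 1) * (k - 1) ^ 2 := by
      rw [beta, mul_pow, mul_pow, Real.sq_sqrt (by positivity), hk]
      ring
    have e2 : beta n (m + 1) ^ 2 = 1 / 4 * ((m : ℝ) + 2) * k ^ 2 := by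
      rw [beta, mul_pow, mul_pow, Real.sq_sqrt (by positivity), hk]
      push_cast
      ring
    have e3 : beta n m ^ 2 * a ^ 2 = beta n (m + 1) ^ 2 * b ^ 2 := by
      rw [← mul_pow, ← mul_pow, eq_neg_of_add_eq_zero_left hr, neg_sq]
    rw [e1, e2] at e3
    linarith
  have h4 : (k + 2) * b ^ 2 ≤ (k - 1) * a ^ 2 := by
    have hp : 0 < ((m : ℝ) + 2) * k ^ 2 := by
      have : 0 < k := by linarith
      positivity
    refine le_of_mul_le_mul_left ?_ hp
    -- The difference of the two sides is $k-m=n\ge0$.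
    have h5 : ((m : ℝ) + 1) * (k + 2) ≤ (m + 2) * (k + 1) := by nlinarith
    have h6 : (k + 1) * (k - 1) ^ 2 ≤ (k - 1) * k ^ 2 := by nlinarith
    calc ((m : ℝ) + 2) * k ^ 2 * ((k + 2) * b ^ 2)
        = (k + 2) * (((m : ℝ) + 2) * k ^ 2 * b ^ 2) := by ring
      _ = (((m : ℝ) + 1) * (k + 2)) * ((k - 1) ^ 2 * a ^ 2) := by rw [← h3]; ring
      _ ≤ ((m + 2) * (k + 1)) * ((k - 1) ^ 2 * a ^ 2) := by gcongr
      _ = (m + 2) * a ^ 2 * ((k + 1) * (k - 1) ^ 2) := by ring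
      _ ≤ (m + 2) * a ^ 2 * ((k - 1) * k ^ 2) := by gcongr
      _ = _ := by ring
  push_cast
  rw [← hk, show (m : ℝ) + 2 + n = k + 2 by rw [hk]; ring]
  linarith

theorem summable_sol_sq (n : ℕ) (y₀ y₁ : ℝ) : Summable fun m => sol n y₀ y₁ m ^ 2 := by
  rw [← summable_nat_add_iff (start n)]
  obtain ⟨e, he⟩ : ∃ e : ℕ → ℝ,
      ∀ j, e j = (((j + start n : ℕ) : ℝ) + n) * sol n y₀ y₁ (j + start n) ^ 2 := ⟨_, fun _ => rfl⟩
  have he0 : ∀ j, 0 ≤ e j := fun j => by rw [he]; positivity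
  -- The recursion has step two, so telescoping leaves two terms at each end.
  have key : ∀ J, ∑ j ∈ Finset.range J, sol n y₀ y₁ (j + start n) ^ 2 ≤
      e 0 + e 1 - e J - e (J + 1) := fun J => by
    induction J with
    | zero => simp
    | succ J ih =>
      have h := sol_sq_le n y₀ y₁ (m := J + start n) (by omega)
      have h1 := he J
      have h2 := he (J + 1 + 1)
      rw [show J + start n + 2 = J + 1 + 1 + start n by omega, ← h1, ← h2] at h
      rw [Finset.sum_range_succ]
      linarith
  exact summable_of_sum_range_le (c := e 0 + e 1) (fun j => sq_nonneg _) fun J => by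
    linarith [key J, he0 J, he0 (J + 1)]

/-- The weighted Wronskian is constant along the recursion; the initial value `1 / β` of `v`
normalizes it. -/
theorem beta_mul_wronskian {n m : ℕ} (hm : start n ≤ m) :
    beta n m * (u n m * v n (m + 1) - u n (m + 1) * v n m) = 1 := by
  induction m, hm using Nat.le_induction with
  | base =>
    rw [u, u, v, v, sol_start, sol_start_succ, sol_start, sol_start_succ, zero_mul, sub_zero,
      one_mul, mul_one_div_cancel (beta_ne_zero le_rfl)]
  | succ m hm ih =>
    have h1 : beta n m * u n m + beta n (m + 1) * u n (m + 2) = 0 := sol_recursion n _ _ m hm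
    have h2 : beta n m * v n m + beta n (m + 1) * v n (m + 2) = 0 := sol_recursion n _ _ m hm
    linear_combination ih + u n (m + 1) * h2 - v n (m + 1) * h1

/-- The Plücker relation for four vectors in the plane, with the $u,v$ determinant normalized to
one. -/
theorem bracket_eq_of_wronskian {n m : ℕ} (hm : start n ≤ m) (g h : ℕ → ℂ) :
    bracket n g h m =
      bracket n g (fun m => (u n m : ℂ)) m * conj (bracket n h (fun m => (v n m : ℂ)) m) -
      bracket n g (fun m => (v n m : ℂ)) m * conj (bracket n h (fun m => (u n m : ℂ)) m) := by
  have hW : (beta n m : ℂ) * ((u n m : ℂ) * v n (m + 1) - u n (m + 1) * v n m) = 1 := by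
    exact_mod_cast beta_mul_wronskian hm
  simp only [bracket, map_mul, map_sub, Complex.conj_ofReal]
  linear_combination (-(beta n m : ℂ) * (g m * conj (h (m + 1)) - g (m + 1) * conj (h m))) * hW

theorem tendsto_bracket_zero {n : ℕ} {g h : ℕ → ℂ} {a b : ℂ}
    (hgu : Tendsto (bracket n g fun m => (u n m : ℂ)) atTop (𝓝 0))
    (hgv : Tendsto (bracket n g fun m => (v n m : ℂ)) atTop (𝓝 0))
    (hhu : Tendsto (bracket n h fun m => (u n m : ℂ)) atTop (𝓝 a))
    (hhv : Tendsto (bracket n h fun m => (v n m : ℂ)) atTop (𝓝 b)) :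
    Tendsto (bracket n g h) atTop (𝓝 0) := by
  have h1 := (hgu.mul ((Complex.continuous_conj.tendsto b).comp hhv)).sub
    (hgv.mul ((Complex.continuous_conj.tendsto a).comp hhu))
  rw [zero_mul, zero_mul, sub_zero] at h1
  refine h1.congr' ?_
  filter_upwards [eventually_ge_atTop (start n)] with m hm
  exact (bracket_eq_of_wronskian hm g h).symm

/-! ### The double adjoint of a graph -/

/-- Up to the rotation $(a,b)\mapsto(b,-a)$ the adjoint of a graph is its orthogonal complement, and
the double complement is the closure. -/
theorem _root_.Submodule.mem_topologicalClosure_iff_adjoint {𝕜 E F : Type*} [RCLike 𝕜]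
    [NormedAddCommGroup E] [InnerProductSpace 𝕜 E] [CompleteSpace E]
    [NormedAddCommGroup F] [InnerProductSpace 𝕜 F] [CompleteSpace F]
    (g : Submodule 𝕜 (E × F)) (x : E × F) :
    x ∈ g.topologicalClosure ↔
      ∀ c d, (c, d) ∈ g.adjoint → inner 𝕜 d x.1 - inner 𝕜 c x.2 = 0 := by
  constructor
  · intro hx c d hcd
    have hc : IsClosed {y : E × F | inner 𝕜 d y.1 - inner 𝕜 c y.2 = 0} :=
      isClosed_eq (by fun_prop) continuous_const
    refine closure_minimal (fun y hy => ?_) hc hx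
    have h := (Submodule.mem_adjoint_iff g _).1 hcd y.1 y.2 hy
    rw [Set.mem_ofPred_eq, ← inner_conj_symm, ← inner_conj_symm c, ← map_sub, ← neg_sub, h, neg_zero,
      map_zero]
  · intro h
    have h1 : WithLp.toLp 2 x ∈
        (g.map (WithLp.linearEquiv 2 𝕜 (E × F)).symm.toLinearMap)ᗮᗮ := by
      rw [Submodule.mem_orthogonal]
      intro y hy
      have h2 : (y.snd, -y.fst) ∈ g.adjoint := by
        rw [Submodule.mem_adjoint_iff]
        intro a b hab
        have h3 := (Submodule.mem_orthogonal _ _).1 hy _ (Submodule.mem_map_of_mem hab)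
        simp only [WithLp.prod_inner_apply] at h3
        rw [inner_neg_right, sub_neg_eq_add, add_comm]
        exact h3
      have h4 := h _ _ h2
      rw [inner_neg_left] at h4
      rw [WithLp.prod_inner_apply]
      change inner 𝕜 y.fst x.1 + inner 𝕜 y.snd x.2 = 0
      linear_combination -h4
    rw [Submodule.orthogonal_orthogonal_eq_closure] at h1
    have h5 : Set.MapsTo (WithLp.ofLp (p := 2) (V := E × F))
        (g.map (WithLp.linearEquiv 2 𝕜 (E × F)).symm.toLinearMap : Set (WithLp 2 (E × F)))
        (g : Set (E × F)) := by
      rintro _ ⟨y, hy, rfl⟩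
      exact hy
    exact h5.closure (WithLp.prod_continuous_ofLp 2 E F) h1

/-! ### Coefficients with respect to the modes -/

theorem hasSum_coeff_mul (f g : L2Plane) :
    HasSum (fun k : ℕ × ℕ => coeff k.1 f k.2 * conj (coeff k.1 g k.2)) (inner ℂ g f) := by
  have h := modeBasis.hasSum_inner_mul_inner g f
  -- The sector index is put first so that the sum can later be taken sector by sector.
  rw [← (Equiv.prodComm ℕ ℕ).hasSum_iff] at h
  refine h.congr_fun fun k => ?_
  simp only [Function.comp_apply, Equiv.prodComm_apply, modeBasis_apply, coeff, inner_conj_symm]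
  exact mul_comm _ _

theorem exists_coeff_eq (n : ℕ) {y : ℕ → ℂ} (hy : Summable fun m => ‖y m‖ ^ 2) :
    ∃ f : L2Plane, ∀ k m, coeff k f m = if k = n then y m else 0 := by
  have hm : Memℓp (fun k : ℕ × ℕ => if k.2 = n then y k.1 else 0) 2 := by
    refine memℓp_gen ?_
    have hi : Function.Injective fun m : ℕ => (m, n) := fun a b h => (Prod.mk.inj h).1
    rw [← hi.summable_iff]
    · simpa [Function.comp_def] using hy
    · rintro ⟨a, b⟩ hab
      have : b ≠ n := fun h => hab ⟨a, by rw [h]⟩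
      simp [this]
  refine ⟨modeBasis.repr.symm ⟨_, hm⟩, fun k m => ?_⟩
  have h := modeBasis.repr_apply_apply (modeBasis.repr.symm ⟨_, hm⟩) (m, k)
  rw [modeBasis_apply, LinearIsometryEquiv.apply_symm_apply] at h
  exact h.symm

theorem mode_mem_sector (m n : ℕ) : mode m n ∈ sector n :=
  Submodule.le_topologicalClosure _ (Submodule.subset_span ⟨m, rfl⟩)

theorem mode_mem_sector_orthogonal {k n : ℕ} (h : k ≠ n) (m : ℕ) : mode m k ∈ (sector n)ᗮ := by
  rw [sector, Submodule.orthogonal_closure, Submodule.mem_orthogonal]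
  intro g hg
  induction hg using Submodule.span_induction with
  | mem g hg => obtain ⟨j, rfl⟩ := hg; exact inner_mode_of_ne_right h.symm j m
  | zero => exact inner_zero_left _
  | add g g' _ _ h h' => rw [inner_add_left, h, h', add_zero]
  | smul c g _ h => rw [inner_smul_left, h, mul_zero]

theorem coeff_P (n k : ℕ) (f : L2Plane) (m : ℕ) :
    coeff k (P n f) m = if k = n then coeff n f m else 0 := by
  have : CompleteSpace (sector n) :=
    (Submodule.isClosed_topologicalClosure _).completeSpace_coe
  have h1 : coeff k (P n f) m = inner ℂ ((sector n).starProjection (mode m k)) f :=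
    (Submodule.inner_starProjection_left_eq_right (sector n) (mode m k) f).symm
  rw [h1]
  split_ifs with h
  · subst h
    rw [Submodule.starProjection_eq_self_iff.2 (mode_mem_sector m k), coeff]
  · rw [(Submodule.starProjection_apply_eq_zero_iff _).2 (mode_mem_sector_orthogonal h m),
      inner_zero_left]

theorem coeff_P_self (n : ℕ) (f : L2Plane) : coeff n (P n f) = coeff n f :=
  funext fun m => by rw [coeff_P, if_pos rfl]

/-! ### The operator and its adjoint -/

theorem mem_T4_graph {x : L2Plane × L2Plane} :
    x ∈ T4.graph ↔ ∃ g ∈ modeSpan, x = (toL2 g, toL2 (t4Expr g)) := by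
  rw [LinearPMap.mem_graph_iff]
  constructor
  · rintro ⟨⟨_, g, hg, rfl⟩, h1, h2⟩
    exact ⟨g, hg, Prod.ext h1.symm (h2.symm.trans (T4_apply g hg))⟩
  · rintro ⟨g, hg, rfl⟩
    exact ⟨⟨toL2 g, Submodule.mem_map_of_mem hg⟩, rfl, T4_apply g hg⟩

theorem dense_T4_domain : Dense (T4.domain : Set L2Plane) := by
  have h : Submodule.span ℂ (Set.range fun k : ℕ × ℕ => mode k.1 k.2) ≤ T4.domain := by
    rw [Submodule.span_le]
    rintro _ ⟨k, rfl⟩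
    exact Submodule.mem_map_of_mem (modeFun_mem_modeSpan k.1 k.2)
  refine Dense.mono h ?_
  rw [Submodule.dense_iff_topologicalClosure_eq_top, Submodule.topologicalClosure_eq_top_iff]
  exact orthogonal_span_mode

theorem inner_creX (f g : Sch) :
    inner ℂ (toL2 f) (toL2 (creX g)) = inner ℂ (toL2 (annX f)) (toL2 g) := by
  rw [← inner_conj_symm, ← inner_annX, inner_conj_symm]

theorem inner_creY (f g : Sch) :
    inner ℂ (toL2 f) (toL2 (creY g)) = inner ℂ (toL2 (annY f)) (toL2 g) := by
  rw [← inner_conj_symm, ← inner_annY, inner_conj_symm]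

/-- Adjunction exchanges $a_x^\dagger$ with $a_x$, $a_x^\dagger a_x^\dagger a_x$ with $a_x^\dagger
a_xa_x$, and the two mixed terms, since $x$ and $y$ operators commute. -/
theorem inner_t4Expr (f g : Sch) :
    inner ℂ (toL2 f) (toL2 (t4Expr g)) = inner ℂ (toL2 (t4Expr f)) (toL2 g) := by
  have hcy : Commute creX (creY * annY) :=
    (show Commute creX creY from creX_mul_creY).mul_right
      (show Commute creX annY from annY_mul_creX.symm)
  have hay : Commute annX creY := annX_mul_creY
  have haa : Commute annX annY := by
    show annX * annY = annY * annX
    rw [annX, annY, smul_mul_smul_comm, smul_mul_smul_comm]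
    simp only [mul_add, add_mul, dX_mul_mulY, mulX_mul_mulY, dX_mul_dY, dY_mul_mulX]
    congr 1
    abel
  have h1 : ∀ f, creX (creY (annY f)) = creY (annY (creX f)) := fun f =>
    LinearMap.congr_fun hcy.eq f
  have h2 : ∀ f, annX (creY (annY f)) = creY (annY (annX f)) := fun f =>
    LinearMap.congr_fun (hay.mul_right haa).eq f
  simp only [t4Expr, LinearMap.smul_apply, LinearMap.sub_apply, LinearMap.add_apply,
    Module.End.mul_apply, map_smul, map_sub, map_add, inner_smul_left, inner_smul_right,
    inner_sub_left, inner_sub_right, inner_add_left, inner_add_right, inner_annX, inner_creX,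
    inner_annY, inner_creY, h1, h2, map_div₀, map_one, map_ofNat]
  ring

theorem inner_t4Expr_modeFun (n m : ℕ) (f : L2Plane) :
    inner ℂ (toL2 (t4Expr (modeFun m n))) f = jacobi n (coeff n f) m := by
  cases m with
  | zero =>
    rw [t4Expr_modeFun_zero, map_smul, inner_smul_left, Complex.conj_ofReal]
    rfl
  | succ m =>
    rw [t4Expr_modeFun_succ, map_add, map_smul, map_smul, inner_add_left, inner_smul_left,
      inner_smul_left, Complex.conj_ofReal, Complex.conj_ofReal]
    rfl

theorem mem_adjoint_graph_iff {f w : L2Plane} :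
    (f, w) ∈ T4.adjoint.graph ↔ ∀ n, coeff n w = jacobi n (coeff n f) := by
  rw [LinearPMap.adjoint_graph_eq_graph_adjoint dense_T4_domain, Submodule.mem_adjoint_iff]
  constructor
  · intro h n
    funext m
    have h1 := h _ _ (mem_T4_graph.2 ⟨modeFun m n, modeFun_mem_modeSpan m n, rfl⟩)
    rw [inner_t4Expr_modeFun, sub_eq_zero] at h1
    exact h1.symm
  · intro h a b hab
    obtain ⟨g, hg, he⟩ := mem_T4_graph.1 hab
    obtain ⟨rfl, rfl⟩ := Prod.mk.inj he
    clear he hab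
    rw [sub_eq_zero]
    induction hg using Submodule.span_induction with
    | mem g hg =>
      obtain ⟨k, rfl⟩ := hg
      rw [inner_t4Expr_modeFun, ← h]
      rfl
    | zero => simp
    | add g g' _ _ h h' => simp only [map_add, inner_add_left, h, h']
    | smul c g _ h => simp only [map_smul, inner_smul_left, h]

theorem T4_le_adjoint : T4 ≤ T4.adjoint := by
  refine LinearPMap.le_of_le_graph fun x hx => ?_
  obtain ⟨g, hg, rfl⟩ := mem_T4_graph.1 hx
  refine mem_adjoint_graph_iff.2 fun n => funext fun m => ?_
  rw [← inner_t4Expr_modeFun, ← inner_t4Expr]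
  rfl

theorem T4_isClosable : T4.IsClosable :=
  (LinearPMap.adjoint_isClosed dense_T4_domain).isClosable.leIsClosable T4_le_adjoint

theorem T4_closure_le_adjoint : T4.closure ≤ T4.adjoint := by
  refine LinearPMap.le_of_le_graph ?_
  rw [← T4_isClosable.graph_closure_eq_closure_graph]
  exact Submodule.topologicalClosure_minimal _ (LinearPMap.le_graph_of_le T4_le_adjoint)
    (LinearPMap.adjoint_isClosed dense_T4_domain)

theorem mem_closure_graph_iff {f w : L2Plane} : (f, w) ∈ T4.closure.graph ↔
    ∀ g z, (g, z) ∈ T4.adjoint.graph → inner ℂ z f - inner ℂ g w = 0 := by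
  rw [← T4_isClosable.graph_closure_eq_closure_graph,
    Submodule.mem_topologicalClosure_iff_adjoint,
    LinearPMap.adjoint_graph_eq_graph_adjoint dense_T4_domain]

/-! ### Boundary values -/

theorem hasSum_greenTerm {f w g z : L2Plane} (hf : (f, w) ∈ T4.adjoint.graph)
    (hg : (g, z) ∈ T4.adjoint.graph) :
    HasSum (fun k : ℕ × ℕ => greenTerm k.1 (coeff k.1 f) (coeff k.1 g) k.2)
      (inner ℂ z f - inner ℂ g w) := by
  have h := (hasSum_coeff_mul f z).sub (hasSum_coeff_mul w g)
  simpa only [greenTerm, ← mem_adjoint_graph_iff.1 hf, ← mem_adjoint_graph_iff.1 hg] using h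

/-- Parseval gives an unconditional double sum of Green terms; summing over $m$ first turns each
sector into a bracket at infinity. -/
theorem exists_boundary_value {f w g z : L2Plane} (hf : (f, w) ∈ T4.adjoint.graph)
    (hg : (g, z) ∈ T4.adjoint.graph) :
    ∃ l : ℕ → ℂ, (∀ n, Tendsto (bracket n (coeff n f) (coeff n g)) atTop (𝓝 (l n))) ∧
      HasSum l (inner ℂ z f - inner ℂ g w) := by
  have h := hasSum_greenTerm hf hg
  have hs : ∀ n, Summable (greenTerm n (coeff n f) (coeff n g)) := fun n =>
    h.summable.prod_factor n
  exact ⟨fun n => ∑' m, greenTerm n (coeff n f) (coeff n g) m,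
    fun n => tendsto_bracket (hs n).hasSum, h.prod_fiberwise fun n => (hs n).hasSum⟩

/-- Supplies the test vectors: the solution placed in a single sector, whose image is a multiple of
one mode. -/
theorem exists_sol_mem_adjoint_graph (n : ℕ) (y₀ y₁ : ℝ) : ∃ g z : L2Plane,
    (g, z) ∈ T4.adjoint.graph ∧
      ∀ k m, coeff k g m = if k = n then (sol n y₀ y₁ m : ℂ) else 0 := by
  obtain ⟨g, hg⟩ := exists_coeff_eq n (y := fun m => (sol n y₀ y₁ m : ℂ))
    (by simpa using summable_sol_sq n y₀ y₁)
  refine ⟨g, ((beta n (start n) * y₁ : ℝ) : ℂ) • mode (start n) n, ?_, hg⟩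
  refine mem_adjoint_graph_iff.2 fun k => funext fun m => ?_
  rw [coeff, inner_smul_right]
  by_cases hk : k = n
  · subst hk
    rw [show coeff k g = fun m => (sol k y₀ y₁ m : ℂ) from funext fun m => by rw [hg, if_pos rfl],
      jacobi_sol]
    split_ifs with hm
    · rw [hm, inner_mode_self, mul_one]
    · rw [inner_mode_of_ne_left hm, mul_zero]
  · rw [inner_mode_of_ne_right hk, mul_zero,
      show coeff k g = fun _ => 0 from funext fun m => by rw [hg, if_neg hk]]
    cases m <;> simp [jacobi]

theorem exists_tendsto_bracket_sol {f w : L2Plane} (hf : (f, w) ∈ T4.adjoint.graph)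
    (n : ℕ) (y₀ y₁ : ℝ) :
    ∃ l, Tendsto (bracket n (coeff n f) fun m => (sol n y₀ y₁ m : ℂ)) atTop (𝓝 l) := by
  obtain ⟨g, z, hg, hc⟩ := exists_sol_mem_adjoint_graph n y₀ y₁
  obtain ⟨l, hl, -⟩ := exists_boundary_value hf hg
  have e : coeff n g = fun m => (sol n y₀ y₁ m : ℂ) := funext fun m => by rw [hc, if_pos rfl]
  exact ⟨l n, e ▸ hl n⟩

theorem tendsto_bracket_sol_zero {f w : L2Plane} (hf : (f, w) ∈ T4.closure.graph)
    (n : ℕ) (y₀ y₁ : ℝ) :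
    Tendsto (bracket n (coeff n f) fun m => (sol n y₀ y₁ m : ℂ)) atTop (𝓝 0) := by
  obtain ⟨g, z, hg, hc⟩ := exists_sol_mem_adjoint_graph n y₀ y₁
  obtain ⟨l, hl, hs⟩ := exists_boundary_value
    (LinearPMap.le_graph_of_le T4_closure_le_adjoint hf) hg
  rw [mem_closure_graph_iff.1 hf g z hg] at hs
  have e : coeff n g = fun m => (sol n y₀ y₁ m : ℂ) := funext fun m => by rw [hc, if_pos rfl]
  -- The test vector lives in sector `n`, so the vanishing boundary form reduces to that sector's
  -- bracket.
  have h0 : ∀ k, k ≠ n → l k = 0 := fun k hk => by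
    refine tendsto_nhds_unique (hl k) (tendsto_const_nhds.congr fun m => ?_)
    simp [bracket, hc, hk]
  rw [← (hasSum_single n h0).unique hs, ← e]
  exact hl n

theorem P_mem_adjoint_graph {f w : L2Plane} (hf : (f, w) ∈ T4.adjoint.graph) (n : ℕ) :
    (P n f, P n w) ∈ T4.adjoint.graph := by
  refine mem_adjoint_graph_iff.2 fun k => funext fun m => ?_
  by_cases hk : k = n
  · subst hk
    rw [coeff_P_self, coeff_P_self, mem_adjoint_graph_iff.1 hf]
  · have e : ∀ g, coeff k (P n g) = fun _ => 0 := fun g => funext fun m => by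
      rw [coeff_P, if_neg hk]
    rw [e, e]
    cases m <;> simp [jacobi]

theorem Gamma1_eq {n : ℕ} {f : L2Plane} {l : ℂ}
    (h : Tendsto (bracket n (coeff n f) fun m => (v n m : ℂ)) atTop (𝓝 l)) : Gamma1 n f = l :=
  h.limUnder_eq

theorem Gamma2_eq {n : ℕ} {f : L2Plane} {l : ℂ}
    (h : Tendsto (bracket n (coeff n f) fun m => (u n m : ℂ)) atTop (𝓝 l)) : Gamma2 n f = l :=
  h.limUnder_eq

/-- A `limUnder` is meaningful only once a limit exists; square summability of the solution provides
it on the adjoint domain. -/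
theorem tendsto_Gamma1 {f w : L2Plane} (hf : (f, w) ∈ T4.adjoint.graph) (n : ℕ) :
    Tendsto (bracket n (coeff n f) fun m => (v n m : ℂ)) atTop (𝓝 (Gamma1 n f)) := by
  obtain ⟨l, hl⟩ := exists_tendsto_bracket_sol hf n 0 (1 / beta n (start n))
  exact (Gamma1_eq hl).symm ▸ hl

theorem tendsto_Gamma2 {f w : L2Plane} (hf : (f, w) ∈ T4.adjoint.graph) (n : ℕ) :
    Tendsto (bracket n (coeff n f) fun m => (u n m : ℂ)) atTop (𝓝 (Gamma2 n f)) := by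
  obtain ⟨l, hl⟩ := exists_tendsto_bracket_sol hf n 1 0
  exact (Gamma2_eq hl).symm ▸ hl

theorem closure_domain_eq : (T4.closure.domain : Set L2Plane) = closureDomain := by
  ext f
  constructor
  · intro hf
    have hg : (f, T4.closure ⟨f, hf⟩) ∈ T4.closure.graph := T4.closure.mem_graph ⟨f, hf⟩
    refine ⟨T4_closure_le_adjoint.1 hf, fun n => ⟨Gamma1_eq ?_, Gamma2_eq ?_⟩⟩ <;>
      rw [coeff_P_self] <;> exact tendsto_bracket_sol_zero hg n _ _
  · rintro ⟨hf, h0⟩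
    have hg : (f, T4.adjoint ⟨f, hf⟩) ∈ T4.adjoint.graph := T4.adjoint.mem_graph ⟨f, hf⟩
    refine LinearPMap.mem_domain_of_mem_graph (y := T4.adjoint ⟨f, hf⟩)
      (mem_closure_graph_iff.2 fun g z hgz => ?_)
    obtain ⟨l, hl, hs⟩ := exists_boundary_value hg hgz
    have hl0 : l = fun _ => 0 := funext fun n => by
      have h1 := tendsto_Gamma1 (P_mem_adjoint_graph hg n) n
      have h2 := tendsto_Gamma2 (P_mem_adjoint_graph hg n) n
      rw [coeff_P_self] at h1 h2
      rw [(h0 n).1] at h1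
      rw [(h0 n).2] at h2
      exact tendsto_nhds_unique (hl n)
        (tendsto_bracket_zero h2 h1 (tendsto_Gamma2 hgz n) (tendsto_Gamma1 hgz n))
    rw [hl0] at hs
    exact hs.unique hasSum_zero

end NonGaussian

end

theorem mainTheorem3 :
    Dense (NonGaussian.T4.domain : Set NonGaussian.L2Plane) ∧
    NonGaussian.T4.IsClosable ∧
    (∀ f ∈ NonGaussian.T4.adjoint.domain, ∀ n : ℕ,
      NonGaussian.P n f ∈ NonGaussian.T4.adjoint.domain ∧
      Tendsto (NonGaussian.bracket n (NonGaussian.coeff n (NonGaussian.P n f))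
          fun m => (NonGaussian.v n m : ℂ)) atTop
        (𝓝 (NonGaussian.Gamma1 n (NonGaussian.P n f))) ∧
      Tendsto (NonGaussian.bracket n (NonGaussian.coeff n (NonGaussian.P n f))
          fun m => (NonGaussian.u n m : ℂ)) atTop
        (𝓝 (NonGaussian.Gamma2 n (NonGaussian.P n f)))) ∧
    NonGaussian.T4.closure ≤ NonGaussian.T4.adjoint ∧
    (NonGaussian.T4.closure.domain : Set NonGaussian.L2Plane) = NonGaussian.closureDomain := by
  refine ⟨NonGaussian.dense_T4_domain, NonGaussian.T4_isClosable, fun f hf n => ?_,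
    NonGaussian.T4_closure_le_adjoint, NonGaussian.closure_domain_eq⟩
  have hg := NonGaussian.P_mem_adjoint_graph (NonGaussian.T4.adjoint.mem_graph ⟨f, hf⟩) n
  exact ⟨LinearPMap.mem_domain_of_mem_graph hg, NonGaussian.tendsto_Gamma1 hg n,
    NonGaussian.tendsto_Gamma2 hg n⟩
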